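/- Let $h>0$, and let $g:[0,\infty)\to[0,\infty)$ be Lipschitz continuous with constant $L_g>1$. For real $c,\lambda$ put $E_c(\lambda)=-\lambda^2+c\lambda+1-L_g e^{-\lambda ch}$ and $$c(L_g)=\inf\{c>0:\ E_c(\lambda)\ge 0\ \text{for some }\lambda\in\mathbb R\}.$$ Let $c\ge c(L_g)$, let $\lambda_1(c)\le\lambda_2(c)$ be the two (possibly coinciding) real solutions of $E_c(\lambda)=0$, fix $\lambda_c\in[\lambda_1(c),\lambda_2(c)]$, and for $b\in\mathbb R$ put $\eta_b(z)=\min\{1,e^{\lambda_c(z-b)}\}$. For an interval $I\subset[0,\infty)$ let $L_g(I)=\sup_{x\ne y;\,x,y\in I}|g(x)-g(y)|/|x-y|$ (with $L_g(I)=0$ if $I$ is a single point). Let $v,\psi:[-h,\infty)\times\mathbb R\to[0,\infty)$ be two classical solutions (continuous on $[0,\infty)\times\mathbb R$, with $v_t,v_z,v_{zz}$ existing for $t>0$) of $$v_t(t,z)=v_{zz}(t,z)-c\,v_z(t,z)-v(t,z)+g(v(t-h,z-ch)),\qquad t>0,\ z\in\mathbb R,$$ whose difference has at most Gaussian growth: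 for every $T>0$ there are $A,B\in\mathbb R$ with $|v(t,z)-\psi(t,z)|\le Ae^{Bz^2}$ for all $(t,z)\in[0,T]\times\mathbb R$. Suppose that for some $b\in\mathbb R$ and some compact interval $I\subset[0,\infty)$ with $L_g(I)<1$, $$\psi(t,z),\,v(t,z)\in I\quad\text{for all }(t,z)\in[-h,\infty)\times[b-ch,\infty),$$ and that for some $q>0$, $$|v(s,z)-\psi(s,z)|\le q\,\eta_b(z)\quad\text{for all }(s,z)\in[-h,0]\times\mathbb R.$$ Then for every $\gamma_0\ge0$ such that $$-\lambda_c^2+c\lambda_c+1\ \ge\ \gamma_0+L_g e^{\gamma_0h}e^{-\lambda_c ch}\quad\text{and}\quad L_g(I)\le e^{-\gamma_0h}(1-\gamma_0),$$ we have $$|v(t,z)-\psi(t,z)|\le q\,e^{-\gamma_0t}\,\eta_b(z)\quad\text{for all }(t,z)\in[-h,\infty)\times\mathbb R.$$ -/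

import Mathlib

open Set
open scoped NNReal

namespace DelayedWave

noncomputable section

/-- A classical (nonnegative) solution `v = v(t, z)`, `t ≥ -h`, of
`v_t(t,z) = v_zz(t,z) - c v_z(t,z) - v(t,z) + g (v(t-h, z-ch))`, `t > 0`, `z ∈ ℝ`.
Its values lie in `[0, ∞)`, the domain of `g`, and its initial datum is its restriction to
`[-h, 0] × ℝ`. Only the values of `v` at times `t ≥ -h` matter. -/
structure IsSolution (g : ℝ → ℝ) (h c : ℝ) (v : ℝ → ℝ → ℝ) : Prop where
  nonneg : ∀ t, -h ≤ t → ∀ z, 0 ≤ v t z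
  continuousOn : ContinuousOn (fun p : ℝ × ℝ => v p.1 p.2) (Ici 0 ×ˢ univ)
  differentiableAt_time : ∀ t, 0 < t → ∀ z, DifferentiableAt ℝ (fun s => v s z) t
  differentiable_space : ∀ t, 0 < t → Differentiable ℝ (v t)
  differentiable_space_deriv : ∀ t, 0 < t → Differentiable ℝ (deriv (v t))
  equation : ∀ t, 0 < t → ∀ z,
    deriv (fun s => v s z) t =
      deriv (deriv (v t)) z - c * deriv (v t) z - v t z + g (v (t - h) (z - c * h))

/-- The function `E_c(lam) = -lam² + c lam + 1 - L e^{-lam c h}`. -/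
def charE (L h c lam : ℝ) : ℝ :=
  -lam ^ 2 + c * lam + 1 - L * Real.exp (-(lam * c * h))

/-- The speed `c(L) = inf {c > 0 : E_c(lam) ≥ 0 for some real lam}`. -/
def criticalSpeed (L h : ℝ) : ℝ :=
  sInf {c : ℝ | 0 < c ∧ ∃ lam : ℝ, 0 ≤ charE L h c lam}

/-- `L_g(I) = sup {|g x - g y| / |x - y| : x, y ∈ I, x ≠ y}` (equal to `0` if `I` is a point). -/
def lipConst (g : ℝ → ℝ) (I : Set ℝ) : ℝ :=
  sSup {r : ℝ | ∃ x ∈ I, ∃ y ∈ I, x ≠ y ∧ r = |g x - g y| / |x - y|}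

/-- The weight `η_b(z) = min {1, e^{lam (z - b)}}`. -/
def eta (lam b z : ℝ) : ℝ :=
  min 1 (Real.exp (lam * (z - b)))

end

end DelayedWave

/-!
The difference `u = v - ψ` solves a linear parabolic equation with a delayed forcing term, and
`r(t, z) = q e^{-γ₀ t} η_b(z)` is a supersolution of it as long as the bound is known one delay
earlier.  Indeed `r` is the minimum of the exponentials `q e^{-γ₀ t} e^{μ (z - b)}`, `μ = 0` and
`μ = lam`.  To the right of `b` the first one is active, the delayed arguments lie in the interval
`I`, and the condition `L_g(I) ≤ e^{-γ₀ h} (1 - γ₀)` is what is needed.  To the left of `b` the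
second one is active, and the condition on the characteristic function at `lam` is what is needed.

Since `r` is a minimum, each exponential touches it from above where it is active, so the kink at
`z = b` causes no difficulty: the maximum principle `le_of_touched_from_above` tests the
inequality only on functions touching `r` from above, as in the definition of viscosity
supersolutions.  The Gaussian growth of `u` is absorbed by adding `ε e^{a(t) z² + M (t - t₀)}` with
`a` increasing, which is a supersolution on short time intervals.  Their length depends on the
growth rate only, so finitely many steps, each no longer than the delay, reach any given time.
-/

namespace DelayedWave

open Filter Topology

/-! ### Derivative tests at a minimum -/

/-- The second-order necessary condition at a local minimum. If the second derivative were
negative, the point would also be a local maximum and the function locally constant. -/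
lemma deriv_deriv_nonneg_of_isLocalMin {f : ℝ → ℝ} {x : ℝ} (hf : ContinuousAt f x)
    (hmin : IsLocalMin f x) : 0 ≤ deriv (deriv f) x := by
  by_contra! hneg
  have hmax : IsLocalMax f x := isLocalMax_of_deriv_deriv_neg hneg hmin.deriv_eq_zero hf
  have hconst : f =ᶠ[𝓝 x] fun _ => f x := by
    filter_upwards [hmin, hmax] with y hy₁ hy₂ using le_antisymm hy₂ hy₁
  have := hconst.deriv.deriv_eq
  simp at this
  linarith

lemma deriv_nonpos_of_forall_le_left {f : ℝ → ℝ} {a x : ℝ} (hax : a < x)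
    (hf : DifferentiableAt ℝ f x) (hmin : ∀ s ∈ Icc a x, f x ≤ f s) : deriv f x ≤ 0 := by
  have hslope := (hasDerivAt_iff_tendsto_slope_left_right.1 hf.hasDerivAt).1
  refine le_of_tendsto hslope ?_
  filter_upwards [Ioo_mem_nhdsLT hax] with s hs
  rw [slope_def_field]
  exact div_nonpos_of_nonneg_of_nonpos (sub_nonneg.2 (hmin s ⟨hs.1.le, hs.2.le⟩))
    (sub_nonpos.2 hs.2.le)

/-! ### The maximum principle under Gaussian growth -/

/-- A space-time function with the regularity of a classical solution at time `t`. -/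
structure IsRegularAt (w : ℝ → ℝ → ℝ) (t : ℝ) : Prop where
  time : ∀ z, DifferentiableAt ℝ (fun s => w s z) t
  space : Differentiable ℝ (w t)
  space_deriv : Differentiable ℝ (deriv (w t))

/-- The linear operator `w ↦ w_t - w_zz + c w_z + w`, evaluated at `(t, z)`. -/
noncomputable def parabolicOp (c : ℝ) (w : ℝ → ℝ → ℝ) (t z : ℝ) : ℝ :=
  deriv (fun s => w s z) t - deriv (deriv (w t)) z + c * deriv (w t) z + w t z

lemma IsRegularAt.add {w₁ w₂ : ℝ → ℝ → ℝ} {t : ℝ} (h₁ : IsRegularAt w₁ t)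
    (h₂ : IsRegularAt w₂ t) : IsRegularAt (fun s y => w₁ s y + w₂ s y) t := by
  have hd : deriv (fun y => w₁ t y + w₂ t y) = fun y => deriv (w₁ t) y + deriv (w₂ t) y :=
    funext fun y => deriv_fun_add (h₁.space y) (h₂.space y)
  refine ⟨fun z => (h₁.time z).fun_add (h₂.time z), h₁.space.fun_add h₂.space, ?_⟩
  rw [hd]
  exact h₁.space_deriv.fun_add h₂.space_deriv

lemma IsRegularAt.sub {w₁ w₂ : ℝ → ℝ → ℝ} {t : ℝ} (h₁ : IsRegularAt w₁ t)
    (h₂ : IsRegularAt w₂ t) : IsRegularAt (fun s y => w₁ s y - w₂ s y) t := by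
  have hd : deriv (fun y => w₁ t y - w₂ t y) = fun y => deriv (w₁ t) y - deriv (w₂ t) y :=
    funext fun y => deriv_fun_sub (h₁.space y) (h₂.space y)
  refine ⟨fun z => (h₁.time z).fun_sub (h₂.time z), h₁.space.fun_sub h₂.space, ?_⟩
  rw [hd]
  exact h₁.space_deriv.fun_sub h₂.space_deriv

lemma parabolicOp_add {w₁ w₂ : ℝ → ℝ → ℝ} {t : ℝ} (c z : ℝ) (h₁ : IsRegularAt w₁ t)
    (h₂ : IsRegularAt w₂ t) :
    parabolicOp c (fun s y => w₁ s y + w₂ s y) t z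
      = parabolicOp c w₁ t z + parabolicOp c w₂ t z := by
  have hd : deriv (fun y => w₁ t y + w₂ t y) = fun y => deriv (w₁ t) y + deriv (w₂ t) y :=
    funext fun y => deriv_fun_add (h₁.space y) (h₂.space y)
  simp only [parabolicOp, hd, deriv_fun_add (h₁.time z) (h₂.time z),
    deriv_fun_add (h₁.space_deriv z) (h₂.space_deriv z)]
  ring

lemma parabolicOp_sub {w₁ w₂ : ℝ → ℝ → ℝ} {t : ℝ} (c z : ℝ) (h₁ : IsRegularAt w₁ t)
    (h₂ : IsRegularAt w₂ t) :
    parabolicOp c (fun s y => w₁ s y - w₂ s y) t z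
      = parabolicOp c w₁ t z - parabolicOp c w₂ t z := by
  have hd : deriv (fun y => w₁ t y - w₂ t y) = fun y => deriv (w₁ t) y - deriv (w₂ t) y :=
    funext fun y => deriv_fun_sub (h₁.space y) (h₂.space y)
  simp only [parabolicOp, hd, deriv_fun_sub (h₁.time z) (h₂.time z),
    deriv_fun_sub (h₁.space_deriv z) (h₂.space_deriv z)]
  ring

/-- The exponential of a function of `(t, z)` that is affine in time and quadratic in space. -/
noncomputable def gaussianBarrier (ε α M t₀ t z : ℝ) : ℝ :=
  ε * Real.exp ((α + 20 * α ^ 2 * (t - t₀)) * z ^ 2 + M * (t - t₀))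

section Barrier

variable (ε α M t₀ t z : ℝ)

lemma hasDerivAt_gaussianBarrier_time :
    HasDerivAt (fun s => gaussianBarrier ε α M t₀ s z)
      ((20 * α ^ 2 * z ^ 2 + M) * gaussianBarrier ε α M t₀ t z) t := by
  have h0 : HasDerivAt (fun s : ℝ => s - t₀) 1 t := (hasDerivAt_id t).sub_const t₀
  have h1 := ((((h0.const_mul (20 * α ^ 2)).const_add α).mul_const (z ^ 2)).add
    (h0.const_mul M)).exp.const_mul ε
  refine h1.congr_deriv ?_
  simp only [gaussianBarrier, Pi.add_apply]
  ring

lemma hasDerivAt_gaussianBarrier_space :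
    HasDerivAt (gaussianBarrier ε α M t₀ t)
      (2 * (α + 20 * α ^ 2 * (t - t₀)) * z * gaussianBarrier ε α M t₀ t z) z := by
  have h1 := ((((hasDerivAt_id z).pow 2).const_mul (α + 20 * α ^ 2 * (t - t₀))).add_const
    (M * (t - t₀))).exp.const_mul ε
  refine h1.congr_deriv ?_
  simp [gaussianBarrier]
  ring

lemma deriv_gaussianBarrier_space :
    deriv (gaussianBarrier ε α M t₀ t) =
      fun z => 2 * (α + 20 * α ^ 2 * (t - t₀)) * z * gaussianBarrier ε α M t₀ t z :=
  funext fun z => (hasDerivAt_gaussianBarrier_space ε α M t₀ t z).deriv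

lemma hasDerivAt_deriv_gaussianBarrier_space :
    HasDerivAt (deriv (gaussianBarrier ε α M t₀ t))
      ((2 * (α + 20 * α ^ 2 * (t - t₀)) + 4 * (α + 20 * α ^ 2 * (t - t₀)) ^ 2 * z ^ 2)
        * gaussianBarrier ε α M t₀ t z) z := by
  rw [deriv_gaussianBarrier_space]
  have h1 := ((hasDerivAt_id z).const_mul (2 * (α + 20 * α ^ 2 * (t - t₀)))).mul
    (hasDerivAt_gaussianBarrier_space ε α M t₀ t z)
  refine h1.congr_deriv ?_
  simp
  ring

lemma isRegularAt_gaussianBarrier : IsRegularAt (gaussianBarrier ε α M t₀) t where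
  time z := (hasDerivAt_gaussianBarrier_time ε α M t₀ t z).differentiableAt
  space z := (hasDerivAt_gaussianBarrier_space ε α M t₀ t z).differentiableAt
  space_deriv z := (hasDerivAt_deriv_gaussianBarrier_space ε α M t₀ t z).differentiableAt

variable {ε α t₀ t}

/-- The Gaussian barrier is a supersolution on short time intervals. With
`a = α + 20 α² (t - t₀) ∈ [α, 2 α]`, the growth `a' = 20 α² ≥ 5 a²` absorbs the term `4 a² z²`
coming from diffusion together with the drift, which is at least `-a² z² - c²`. -/
lemma parabolicOp_gaussianBarrier_nonneg (c : ℝ) (hε : 0 ≤ ε) (hα : 0 ≤ α) (ht₀ : t₀ ≤ t)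
    (ht : 20 * α * (t - t₀) ≤ 1) :
    0 ≤ parabolicOp c (gaussianBarrier ε α (4 * α + c ^ 2) t₀) t z := by
  rw [parabolicOp, (hasDerivAt_gaussianBarrier_time _ _ _ _ _ _).deriv,
    (hasDerivAt_deriv_gaussianBarrier_space _ _ _ _ _ _).deriv,
    (hasDerivAt_gaussianBarrier_space _ _ _ _ _ _).deriv]
  set a := α + 20 * α ^ 2 * (t - t₀) with ha
  have ha0 : 0 ≤ a := by
    have := sub_nonneg.2 ht₀
    positivity
  have ha2 : a ≤ 2 * α := by nlinarith
  have hasq : a ^ 2 ≤ 4 * α ^ 2 := by nlinarith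
  have hz := mul_le_mul_of_nonneg_right hasq (sq_nonneg z)
  have hΦ : 0 ≤ gaussianBarrier ε α (4 * α + c ^ 2) t₀ t z :=
    mul_nonneg hε (Real.exp_pos _).le
  have key : 0 ≤ 20 * α ^ 2 * z ^ 2 + (4 * α + c ^ 2) - (2 * a + 4 * a ^ 2 * z ^ 2)
      + c * (2 * a * z) + 1 := by
    nlinarith [sq_nonneg (a * z + c)]
  calc (0 : ℝ) ≤ _ := mul_nonneg key hΦ
    _ = _ := by ring

end Barrier

/-- A maximum principle on the whole line, on a time interval that is short compared with the
Gaussian growth rate `B`. The function `r` is a supersolution in the viscosity sense: at each point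
some regular function `ρ` touches it from above and satisfies the differential inequality there. -/
lemma le_of_touched_from_above {c A B t₀ t₁ : ℝ} {u r : ℝ → ℝ → ℝ}
    (hA : 0 ≤ A) (hB : 0 ≤ B) (ht : 20 * (B + 1) * (t₁ - t₀) ≤ 1)
    (hu_cont : ContinuousOn (fun p : ℝ × ℝ => u p.1 p.2) (Icc t₀ t₁ ×ˢ univ))
    (hr_cont : Continuous (fun p : ℝ × ℝ => r p.1 p.2))
    (hr_nonneg : ∀ t z, 0 ≤ r t z)
    (hu_reg : ∀ t ∈ Ioc t₀ t₁, IsRegularAt u t)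
    (hu_growth : ∀ t ∈ Icc t₀ t₁, ∀ z, u t z ≤ A * Real.exp (B * z ^ 2))
    (hinit : ∀ z, u t₀ z ≤ r t₀ z)
    (hsuper : ∀ t ∈ Ioc t₀ t₁, ∀ z, ∃ ρ : ℝ → ℝ → ℝ, IsRegularAt ρ t ∧
      (∀ s y, r s y ≤ ρ s y) ∧ ρ t z = r t z ∧ parabolicOp c u t z ≤ parabolicOp c ρ t z) :
    ∀ t ∈ Icc t₀ t₁, ∀ z, u t z ≤ r t z := by
  have hα : 0 ≤ B + 1 := by linarith
  set Φ : ℝ → ℝ → ℝ → ℝ :=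
    fun ε => gaussianBarrier ε (B + 1) (4 * (B + 1) + c ^ 2) t₀ with hΦ
  have main : ∀ ε > 0, ∀ t ∈ Icc t₀ t₁, ∀ z, u t z ≤ r t z + Φ ε t z := by
    intro ε hε t ht' z
    by_contra! hlt
    set R := A / ε + 1 with hR
    have hR1 : 1 ≤ R := by
      have : 0 ≤ A / ε := by positivity
      linarith
    -- outside `[-R, R]` the barrier dominates the Gaussian bound, as `e^{z²} ≥ z² ≥ A / ε`
    have hfar : ∀ s ∈ Icc t₀ t₁, ∀ y, R ≤ |y| → u s y ≤ r s y + Φ ε s y := by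
      intro s hs y hy
      have h1 : A ≤ ε * y ^ 2 := by
        have h2 : A / ε ≤ y ^ 2 := by
          rw [← sq_abs]
          nlinarith
        rwa [div_le_iff₀' hε] at h2
      have h3 : y ^ 2 ≤ Real.exp (y ^ 2) := by linarith [Real.add_one_le_exp (y ^ 2)]
      have hs0 : 0 ≤ s - t₀ := sub_nonneg.2 hs.1
      calc u s y ≤ A * Real.exp (B * y ^ 2) := hu_growth s hs y
        _ ≤ ε * Real.exp (y ^ 2) * Real.exp (B * y ^ 2) := by
          gcongr
          exact h1.trans (mul_le_mul_of_nonneg_left h3 hε.le)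
        _ = ε * Real.exp ((B + 1) * y ^ 2) := by
          rw [mul_assoc, ← Real.exp_add]
          ring_nf
        _ ≤ Φ ε s y := by
          refine mul_le_mul_of_nonneg_left (Real.exp_le_exp.2 ?_) hε.le
          have : 0 ≤ 20 * (B + 1) ^ 2 * (s - t₀) * y ^ 2 + (4 * (B + 1) + c ^ 2) * (s - t₀) := by
            positivity
          linarith
        _ ≤ r s y + Φ ε s y := le_add_of_nonneg_left (hr_nonneg s y)
    have hz : |z| ≤ R := by
      by_contra! hz
      exact absurd (hfar t ht' z hz.le) (not_le.2 hlt)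
    have hΦ_cont : Continuous (fun p : ℝ × ℝ => Φ ε p.1 p.2) := by
      simp only [hΦ, gaussianBarrier]
      fun_prop
    have hcont : ContinuousOn (fun p : ℝ × ℝ => r p.1 p.2 + Φ ε p.1 p.2 - u p.1 p.2)
        (Icc t₀ t₁ ×ˢ Icc (-R) R) :=
      (hr_cont.add hΦ_cont).continuousOn.sub (hu_cont.mono (prod_mono_right (subset_univ _)))
    have htz : (t, z) ∈ Icc t₀ t₁ ×ˢ Icc (-R) R := ⟨ht', abs_le.1 hz⟩
    obtain ⟨⟨τ, ζ⟩, ⟨hτ, hζ⟩, hmin⟩ :=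
      (isCompact_Icc.prod isCompact_Icc).exists_isMinOn ⟨_, htz⟩ hcont
    simp only at hτ hζ
    have hmin' : ∀ s ∈ Icc t₀ t₁, ∀ y ∈ Icc (-R) R,
        r τ ζ + Φ ε τ ζ - u τ ζ ≤ r s y + Φ ε s y - u s y :=
      fun s hs y hy => hmin (show (s, y) ∈ Icc t₀ t₁ ×ˢ Icc (-R) R from ⟨hs, hy⟩)
    have hneg : r τ ζ + Φ ε τ ζ - u τ ζ < 0 :=
      (hmin' t ht' z (abs_le.1 hz)).trans_lt (by linarith)
    have hτ0 : t₀ < τ := by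
      refine lt_of_le_of_ne hτ.1 fun h => ?_
      have h1 := hinit ζ
      have h2 : 0 ≤ Φ ε τ ζ := mul_nonneg hε.le (Real.exp_pos _).le
      rw [h] at h1
      linarith
    have hζR : |ζ| < R := by
      by_contra! h
      linarith [hfar τ hτ ζ h]
    obtain ⟨ρ, hρ_reg, hρ_le, hρ_eq, hρ_op⟩ := hsuper τ ⟨hτ0, hτ.2⟩ ζ
    have hΦ_reg : IsRegularAt (Φ ε) τ := isRegularAt_gaussianBarrier _ _ _ _ _
    have hu := hu_reg τ ⟨hτ0, hτ.2⟩
    -- the touching function inherits the minimum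
    set w : ℝ → ℝ → ℝ := fun s y => ρ s y + Φ ε s y - u s y with hw
    have hw_reg : IsRegularAt w τ := (hρ_reg.add hΦ_reg).sub hu
    have hw_min : ∀ s ∈ Icc t₀ t₁, ∀ y ∈ Icc (-R) R, w τ ζ ≤ w s y := by
      intro s hs y hy
      have h1 := hmin' s hs y hy
      have h2 := hρ_le s y
      simp only [hw]
      linarith
    have hw_neg : w τ ζ < 0 := by
      simp only [hw]
      linarith
    have hw_loc : IsLocalMin (w τ) ζ := by
      filter_upwards [Icc_mem_nhds (abs_lt.1 hζR).1 (abs_lt.1 hζR).2] with y hy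
        using hw_min τ hτ y hy
    have h1 := deriv_deriv_nonneg_of_isLocalMin (hw_reg.space ζ).continuousAt hw_loc
    have h2 := hw_loc.deriv_eq_zero
    have h3 : deriv (fun s => w s ζ) τ ≤ 0 :=
      deriv_nonpos_of_forall_le_left hτ0 (hw_reg.time ζ)
        fun s hs => hw_min s ⟨hs.1, hs.2.trans hτ.2⟩ ζ hζ
    have h4 : parabolicOp c w τ ζ < 0 := by
      rw [parabolicOp, h2]
      linarith
    have h5 : parabolicOp c w τ ζ
        = parabolicOp c ρ τ ζ + parabolicOp c (Φ ε) τ ζ - parabolicOp c u τ ζ := by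
      rw [hw, parabolicOp_sub c ζ (hρ_reg.add hΦ_reg) hu, parabolicOp_add c ζ hρ_reg hΦ_reg]
    have h6 : 0 ≤ parabolicOp c (Φ ε) τ ζ :=
      parabolicOp_gaussianBarrier_nonneg ζ c hε.le hα hτ.1
        ((mul_le_mul_of_nonneg_left (sub_le_sub_right hτ.2 t₀) (by positivity)).trans ht)
    linarith
  intro t ht' z
  refine le_of_forall_pos_le_add fun δ hδ => ?_
  have hpos : 0 < Φ 1 t z := mul_pos one_pos (Real.exp_pos _)
  have h := main (δ / Φ 1 t z) (by positivity) t ht' z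
  have hscale : Φ (δ / Φ 1 t z) t z = δ / Φ 1 t z * Φ 1 t z := by
    simp only [hΦ, gaussianBarrier, one_mul]
  rwa [hscale, div_mul_cancel₀ _ hpos.ne'] at h

/-! ### The exponential weights -/

/-- The smooth branches of the supersolution `q e^{-γ t} η_b(z)`. -/
noncomputable def expBranch (q γ μ b t z : ℝ) : ℝ :=
  q * Real.exp (-(γ * t)) * Real.exp (μ * (z - b))

section Branch

variable (q γ μ b t z : ℝ)

lemma hasDerivAt_expBranch_time :
    HasDerivAt (fun s => expBranch q γ μ b s z) (-γ * expBranch q γ μ b t z) t := by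
  have h1 := ((((hasDerivAt_id t).const_mul γ).neg.exp).const_mul q).mul_const
    (Real.exp (μ * (z - b)))
  refine h1.congr_deriv ?_
  simp [expBranch]
  ring

lemma hasDerivAt_expBranch_space :
    HasDerivAt (expBranch q γ μ b t) (μ * expBranch q γ μ b t z) z := by
  have h1 := ((((hasDerivAt_id z).sub_const b).const_mul μ).exp).const_mul
    (q * Real.exp (-(γ * t)))
  refine h1.congr_deriv ?_
  simp [expBranch]
  ring

lemma hasDerivAt_deriv_expBranch_space :
    HasDerivAt (deriv (expBranch q γ μ b t)) (μ ^ 2 * expBranch q γ μ b t z) z := by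
  have hd : deriv (expBranch q γ μ b t) = fun y => μ * expBranch q γ μ b t y :=
    funext fun y => (hasDerivAt_expBranch_space q γ μ b t y).deriv
  rw [hd]
  exact ((hasDerivAt_expBranch_space q γ μ b t z).const_mul μ).congr_deriv (by ring)

lemma isRegularAt_expBranch : IsRegularAt (expBranch q γ μ b) t where
  time z := (hasDerivAt_expBranch_time q γ μ b t z).differentiableAt
  space z := (hasDerivAt_expBranch_space q γ μ b t z).differentiableAt
  space_deriv z := (hasDerivAt_deriv_expBranch_space q γ μ b t z).differentiableAt

lemma parabolicOp_expBranch (c : ℝ) :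
    parabolicOp c (expBranch q γ μ b) t z
      = (-μ ^ 2 + c * μ + 1 - γ) * expBranch q γ μ b t z := by
  rw [parabolicOp, (hasDerivAt_expBranch_time _ _ _ _ _ _).deriv,
    (hasDerivAt_deriv_expBranch_space _ _ _ _ _ _).deriv,
    (hasDerivAt_expBranch_space _ _ _ _ _ _).deriv]
  ring

end Branch

lemma eta_nonneg (lam b z : ℝ) : 0 ≤ eta lam b z := le_min zero_le_one (Real.exp_pos _).le

lemma eta_le_one (lam b z : ℝ) : eta lam b z ≤ 1 := min_le_left _ _

lemma eta_le_exp (lam b z : ℝ) : eta lam b z ≤ Real.exp (lam * (z - b)) := min_le_right _ _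

lemma eta_eq_one {lam b z : ℝ} (hlam : 0 ≤ lam) (hz : b ≤ z) : eta lam b z = 1 :=
  min_eq_left (Real.one_le_exp (mul_nonneg hlam (sub_nonneg.2 hz)))

lemma eta_eq_exp {lam b z : ℝ} (hlam : 0 ≤ lam) (hz : z ≤ b) :
    eta lam b z = Real.exp (lam * (z - b)) :=
  min_eq_right (Real.exp_le_one_iff.2 (mul_nonpos_of_nonneg_of_nonpos hlam (sub_nonpos.2 hz)))

lemma charE_neg_of_nonpos {L h c lam : ℝ} (hL : 1 < L) (hh : 0 ≤ h) (hc : 0 ≤ c)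
    (hlam : lam ≤ 0) : charE L h c lam < 0 := by
  have h1 : 0 ≤ -(lam * c * h) := by
    have := mul_nonneg (mul_nonneg (neg_nonneg.2 hlam) hc) hh
    linarith
  have h2 := Real.one_le_exp h1
  have h3 : L ≤ L * Real.exp (-(lam * c * h)) := le_mul_of_one_le_right (by linarith) h2
  have h4 : c * lam ≤ 0 := mul_nonpos_of_nonneg_of_nonpos hc hlam
  rw [charE]
  nlinarith [sq_nonneg lam]

lemma criticalSpeed_nonneg (L h : ℝ) : 0 ≤ criticalSpeed L h :=
  Real.sInf_nonneg fun _ hx => hx.1.le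

/-! ### The delayed nonlinearity -/

lemma lipConst_nonneg (g : ℝ → ℝ) (I : Set ℝ) : 0 ≤ lipConst g I :=
  Real.sSup_nonneg (by rintro _ ⟨x, _, y, _, _, rfl⟩; positivity)

lemma abs_sub_le_mul_of_lipschitzOnWith {g : ℝ → ℝ} {L : ℝ≥0} {S : Set ℝ}
    (hg : LipschitzOnWith L g S) {x y : ℝ} (hx : x ∈ S) (hy : y ∈ S) :
    |g x - g y| ≤ L * |x - y| := by
  simpa [Real.dist_eq] using hg.dist_le_mul x hx y hy

/-- The supremum defining `lipConst` is a Lipschitz constant; it is finite because `g` is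
Lipschitz on a larger set. -/
lemma abs_sub_le_lipConst_mul {g : ℝ → ℝ} {L : ℝ≥0} {I S : Set ℝ} (hIS : I ⊆ S)
    (hg : LipschitzOnWith L g S) {x y : ℝ} (hx : x ∈ I) (hy : y ∈ I) :
    |g x - g y| ≤ lipConst g I * |x - y| := by
  rcases eq_or_ne x y with rfl | hxy
  · simp
  have hbdd : BddAbove {r : ℝ | ∃ x ∈ I, ∃ y ∈ I, x ≠ y ∧ r = |g x - g y| / |x - y|} := by
    refine ⟨L, ?_⟩
    rintro _ ⟨x, hx, y, hy, hxy, rfl⟩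
    rw [div_le_iff₀ (abs_pos.2 (sub_ne_zero.2 hxy))]
    exact abs_sub_le_mul_of_lipschitzOnWith hg (hIS hx) (hIS hy)
  rw [← div_le_iff₀ (abs_pos.2 (sub_ne_zero.2 hxy))]
  exact le_csSup hbdd ⟨x, hx, y, hy, hxy, rfl⟩

lemma IsSolution.isRegularAt {g : ℝ → ℝ} {h c : ℝ} {v : ℝ → ℝ → ℝ} (hv : IsSolution g h c v)
    {t : ℝ} (ht : 0 < t) : IsRegularAt v t :=
  ⟨hv.differentiableAt_time t ht, hv.differentiable_space t ht,
    hv.differentiable_space_deriv t ht⟩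

lemma IsSolution.parabolicOp_eq {g : ℝ → ℝ} {h c : ℝ} {v : ℝ → ℝ → ℝ}
    (hv : IsSolution g h c v) {t : ℝ} (ht : 0 < t) (z : ℝ) :
    parabolicOp c v t z = g (v (t - h) (z - c * h)) := by
  rw [parabolicOp, hv.equation t ht z]
  ring

/-! ### Propagation of the bound -/

/-- One time step, no longer than the delay, of the one-sided estimate. -/
lemma sub_le_of_forall_abs_sub_le {g : ℝ → ℝ} {L : ℝ≥0} {h c b q lam γ A B t₀ t₁ : ℝ}
    {I : Set ℝ} {v ψ : ℝ → ℝ → ℝ}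
    (hg : LipschitzOnWith L g (Ici 0)) (hI : I ⊆ Ici 0)
    (hv : IsSolution g h c v) (hψ : IsSolution g h c ψ)
    (hlam : 0 ≤ lam) (hq : 0 ≤ q)
    (hinv : ∀ t, -h ≤ t → ∀ z, b - c * h ≤ z → ψ t z ∈ I ∧ v t z ∈ I)
    (hγ : γ + L * Real.exp (γ * h) * Real.exp (-(lam * c * h)) ≤ -lam ^ 2 + c * lam + 1)
    (hγI : lipConst g I ≤ Real.exp (-(γ * h)) * (1 - γ))
    (ht₀ : 0 ≤ t₀) (hstep : t₁ - t₀ ≤ h)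
    (hA : 0 ≤ A) (hB : 0 ≤ B) (hshort : 20 * (B + 1) * (t₁ - t₀) ≤ 1)
    (hgrowth : ∀ t ∈ Icc t₀ t₁, ∀ z, v t z - ψ t z ≤ A * Real.exp (B * z ^ 2))
    (hprev : ∀ t, -h ≤ t → t ≤ t₀ → ∀ z,
      |v t z - ψ t z| ≤ q * Real.exp (-(γ * t)) * eta lam b z)
    (hh : 0 ≤ h) :
    ∀ t ∈ Icc t₀ t₁, ∀ z, v t z - ψ t z ≤ q * Real.exp (-(γ * t)) * eta lam b z := by
  refine le_of_touched_from_above (c := c) (u := fun t z => v t z - ψ t z)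
    (r := fun t z => q * Real.exp (-(γ * t)) * eta lam b z) hA hB hshort ?_ ?_ ?_ ?_ hgrowth ?_ ?_
  · have hsub : Icc t₀ t₁ ×ˢ (univ : Set ℝ) ⊆ Ici 0 ×ˢ univ :=
      prod_mono_left fun t ht => ht₀.trans ht.1
    exact (hv.continuousOn.mono hsub).sub (hψ.continuousOn.mono hsub)
  · simp only [eta]
    fun_prop
  · exact fun t z => mul_nonneg (by positivity) (eta_nonneg _ _ _)
  · exact fun t ht => (hv.isRegularAt (ht₀.trans_lt ht.1)).sub (hψ.isRegularAt (ht₀.trans_lt ht.1))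
  · exact fun z => (le_abs_self _).trans (hprev t₀ (by linarith) le_rfl z)
  intro t ht z
  have ht_pos : 0 < t := ht₀.trans_lt ht.1
  have hdelay : -h ≤ t - h := by linarith
  have hop : parabolicOp c (fun t z => v t z - ψ t z) t z
      = g (v (t - h) (z - c * h)) - g (ψ (t - h) (z - c * h)) := by
    rw [parabolicOp_sub c z (hv.isRegularAt ht_pos) (hψ.isRegularAt ht_pos),
      hv.parabolicOp_eq ht_pos, hψ.parabolicOp_eq ht_pos]
  have hbound := hprev (t - h) hdelay (by linarith [ht.2]) (z - c * h)
  have hexp : Real.exp (-(γ * (t - h))) = Real.exp (-(γ * t)) * Real.exp (γ * h) := by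
    rw [← Real.exp_add]
    ring_nf
  rw [hexp] at hbound
  rcases le_total b z with hz | hz
  · refine ⟨expBranch q γ 0 b, isRegularAt_expBranch _ _ _ _ _, fun s y => ?_, ?_, ?_⟩
    · simpa [expBranch] using
        mul_le_mul_of_nonneg_left (eta_le_one lam b y) (by positivity : 0 ≤ q * Real.exp (-(γ * s)))
    · simp [expBranch, eta_eq_one hlam hz]
    obtain ⟨hψI, hvI⟩ := hinv (t - h) hdelay (z - c * h) (by linarith)
    rw [hop, parabolicOp_expBranch]
    calc g (v (t - h) (z - c * h)) - g (ψ (t - h) (z - c * h))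
        ≤ |g (v (t - h) (z - c * h)) - g (ψ (t - h) (z - c * h))| := le_abs_self _
      _ ≤ lipConst g I * |v (t - h) (z - c * h) - ψ (t - h) (z - c * h)| :=
        abs_sub_le_lipConst_mul hI hg hvI hψI
      _ ≤ lipConst g I * (q * (Real.exp (-(γ * t)) * Real.exp (γ * h)) * 1) := by
        refine mul_le_mul_of_nonneg_left (hbound.trans ?_) (lipConst_nonneg g I)
        exact mul_le_mul_of_nonneg_left (eta_le_one _ _ _) (by positivity)
      _ ≤ Real.exp (-(γ * h)) * (1 - γ) * (q * (Real.exp (-(γ * t)) * Real.exp (γ * h)) * 1) :=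
        mul_le_mul_of_nonneg_right hγI (by positivity)
      _ = (Real.exp (-(γ * h)) * Real.exp (γ * h)) * ((1 - γ) * (q * Real.exp (-(γ * t)))) := by
        ring
      _ = (-0 ^ 2 + c * 0 + 1 - γ) * expBranch q γ 0 b t z := by
        rw [← Real.exp_add]
        simp [expBranch]
  · refine ⟨expBranch q γ lam b, isRegularAt_expBranch _ _ _ _ _, fun s y => ?_, ?_, ?_⟩
    · exact mul_le_mul_of_nonneg_left (eta_le_exp lam b y) (by positivity)
    · simp only [expBranch, eta_eq_exp hlam hz]
    rw [hop, parabolicOp_expBranch]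
    have hshift : Real.exp (lam * (z - c * h - b))
        = Real.exp (lam * (z - b)) * Real.exp (-(lam * c * h)) := by
      rw [← Real.exp_add]
      ring_nf
    calc g (v (t - h) (z - c * h)) - g (ψ (t - h) (z - c * h))
        ≤ |g (v (t - h) (z - c * h)) - g (ψ (t - h) (z - c * h))| := le_abs_self _
      _ ≤ L * |v (t - h) (z - c * h) - ψ (t - h) (z - c * h)| :=
        abs_sub_le_mul_of_lipschitzOnWith hg (hv.nonneg _ hdelay _) (hψ.nonneg _ hdelay _)
      _ ≤ L * (q * (Real.exp (-(γ * t)) * Real.exp (γ * h))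
            * (Real.exp (lam * (z - b)) * Real.exp (-(lam * c * h)))) := by
        rw [← hshift]
        refine mul_le_mul_of_nonneg_left (hbound.trans ?_) L.coe_nonneg
        exact mul_le_mul_of_nonneg_left (eta_le_exp _ _ _) (by positivity)
      _ = L * Real.exp (γ * h) * Real.exp (-(lam * c * h)) * expBranch q γ lam b t z := by
        rw [expBranch]
        ring
      _ ≤ (-lam ^ 2 + c * lam + 1 - γ) * expBranch q γ lam b t z := by
        refine mul_le_mul_of_nonneg_right (by linarith) ?_
        rw [expBranch]
        positivity

end DelayedWave

theorem mainTheorem7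
    (g : ℝ → ℝ) (L : ℝ≥0) (h c b q : ℝ) (lam₁ lam₂ lam : ℝ) (i₁ i₂ : ℝ)
    (v ψ : ℝ → ℝ → ℝ)
    (hh : 0 < h)
    (hg_maps : MapsTo g (Ici 0) (Ici 0))
    (hg_lip : LipschitzOnWith L g (Ici 0))
    (hL : 1 < L)
    (hc : DelayedWave.criticalSpeed L h ≤ c)
    (hlam_le : lam₁ ≤ lam₂)
    (hlam_roots : ∀ x : ℝ, DelayedWave.charE L h c x = 0 ↔ x = lam₁ ∨ x = lam₂)
    (hlam : lam ∈ Icc lam₁ lam₂)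
    (hv : DelayedWave.IsSolution g h c v)
    (hψ : DelayedWave.IsSolution g h c ψ)
    -- the growth class in which the maximum principle on the whole line is valid
    (hgrowth : ∀ T : ℝ, 0 < T → ∃ A B : ℝ, ∀ t ∈ Icc 0 T, ∀ z : ℝ,
      |v t z - ψ t z| ≤ A * Real.exp (B * z ^ 2))
    (hI_dom : 0 ≤ i₁) (hI : i₁ ≤ i₂)
    (hI_lip : DelayedWave.lipConst g (Icc i₁ i₂) < 1)
    (hinv : ∀ t, -h ≤ t → ∀ z, b - c * h ≤ z → ψ t z ∈ Icc i₁ i₂ ∧ v t z ∈ Icc i₁ i₂)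
    (hq : 0 < q)
    (hinit : ∀ s ∈ Icc (-h) 0, ∀ z : ℝ, |v s z - ψ s z| ≤ q * DelayedWave.eta lam b z) :
    ∀ γ₀ : ℝ, 0 ≤ γ₀ →
      γ₀ + L * Real.exp (γ₀ * h) * Real.exp (-(lam * c * h)) ≤ -lam ^ 2 + c * lam + 1 →
      DelayedWave.lipConst g (Icc i₁ i₂) ≤ Real.exp (-(γ₀ * h)) * (1 - γ₀) →
      ∀ t, -h ≤ t → ∀ z : ℝ,
        |v t z - ψ t z| ≤ q * Real.exp (-(γ₀ * t)) * DelayedWave.eta lam b z := by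
  open DelayedWave in
  intro γ hγ0 hγ hγI t ht z
  have hc0 : 0 ≤ c := (criticalSpeed_nonneg L h).trans hc
  have hlam0 : 0 ≤ lam := by
    by_contra! hneg
    have h1 := charE_neg_of_nonpos (L := L) (by exact_mod_cast hL) hh.le hc0
      (hlam.1.trans hneg.le)
    have h2 := (hlam_roots lam₁).2 (Or.inl rfl)
    linarith
  set T := |t| + 1 with hT
  have hT0 : 0 < T := by positivity
  obtain ⟨A, B, hAB⟩ := hgrowth T hT0
  -- the growth constants may be taken nonnegative
  have hAB' : ∀ s ∈ Icc 0 T, ∀ y, |v s y - ψ s y| ≤ |A| * Real.exp (|B| * y ^ 2) := by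
    intro s hs y
    refine (hAB s hs y).trans ?_
    gcongr
    · exact le_abs_self A
    · exact le_abs_self B
  set δ := min h (1 / (20 * (|B| + 1))) with hδ
  have hδ0 : 0 < δ := lt_min hh (by positivity)
  have hδB : 20 * (|B| + 1) * δ ≤ 1 := by
    have h1 : δ ≤ 1 / (20 * (|B| + 1)) := min_le_right _ _
    rwa [le_div_iff₀' (by positivity)] at h1
  have hinit' : ∀ s, -h ≤ s → s ≤ 0 → ∀ y,
      |v s y - ψ s y| ≤ q * Real.exp (-(γ * s)) * eta lam b y := by
    intro s hs hs0 y
    refine (hinit s ⟨hs, hs0⟩ y).trans ?_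
    have h1 : 1 ≤ Real.exp (-(γ * s)) :=
      Real.one_le_exp (neg_nonneg.2 (mul_nonpos_of_nonneg_of_nonpos hγ0 hs0))
    exact mul_le_mul_of_nonneg_right (le_mul_of_one_le_right hq.le h1) (eta_nonneg _ _ _)
  have hsteps : ∀ n : ℕ, ∀ s, -h ≤ s → s ≤ n * δ → s ≤ T → ∀ y,
      |v s y - ψ s y| ≤ q * Real.exp (-(γ * s)) * eta lam b y := by
    intro n
    induction n with
    | zero =>
      intro s hs hs0 _ y
      exact hinit' s hs (by simpa using hs0) y
    | succ n ih =>
      intro s hs hsn hsT y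
      rcases le_total s (n * δ) with hle | hge
      · exact ih s hs hle hsT y
      have hn : (0 : ℝ) ≤ n * δ := by positivity
      have hlen : s - n * δ ≤ δ := by
        push_cast at hsn
        linarith
      have hshort : 20 * (|B| + 1) * (s - n * δ) ≤ 1 :=
        (mul_le_mul_of_nonneg_left hlen (by positivity)).trans hδB
      have hdelay : s - n * δ ≤ h := hlen.trans (min_le_left _ _)
      have hI0 : Icc i₁ i₂ ⊆ Ici 0 := fun x hx => hI_dom.trans hx.1
      have hprev : ∀ τ, -h ≤ τ → τ ≤ n * δ → ∀ y,
          |v τ y - ψ τ y| ≤ q * Real.exp (-(γ * τ)) * eta lam b y :=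
        fun τ h1 h2 => ih τ h1 h2 (h2.trans (hge.trans hsT))
      have hgr : ∀ τ ∈ Icc (n * δ) s, ∀ y, |v τ y - ψ τ y| ≤ |A| * Real.exp (|B| * y ^ 2) :=
        fun τ hτ => hAB' τ ⟨hn.trans hτ.1, hτ.2.trans hsT⟩
      have h1 := sub_le_of_forall_abs_sub_le hg_lip hI0 hv hψ hlam0 hq.le hinv hγ hγI hn hdelay
        (abs_nonneg A) (abs_nonneg B) hshort
        (fun τ hτ y => (le_abs_self _).trans (hgr τ hτ y)) hprev hh.le s ⟨hge, le_rfl⟩ y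
      have h2 := sub_le_of_forall_abs_sub_le hg_lip hI0 hψ hv hlam0 hq.le
        (fun τ hτ y hy => (hinv τ hτ y hy).symm) hγ hγI hn hdelay
        (abs_nonneg A) (abs_nonneg B) hshort
        (fun τ hτ y => (le_abs_self _).trans (by rw [abs_sub_comm]; exact hgr τ hτ y))
        (fun τ hτ hτ' y => by rw [abs_sub_comm]; exact hprev τ hτ hτ' y)
        hh.le s ⟨hge, le_rfl⟩ y
      exact abs_sub_le_iff.2 ⟨h1, h2⟩
  obtain ⟨n, hn⟩ := exists_nat_ge (t / δ)
  exact hsteps n t ht ((div_le_iff₀ hδ0).1 hn) ((le_abs_self t).trans (by linarith)) z
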